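/- **Proposition (Asymptotic distribution of the total loss).** Let $(X_i)_{i\ge 1}$ be real random variables (average claim sizes) and $(Y_i)_{i\ge 1}$ be $\mathbb{N}$-valued maps (numbers of claims) on a common probability space such that the policy losses $L_i := X_iY_i$ are independent random variables. Where the variances exist, put $\mu_{L_i}=E(L_i)$, $\sigma_{L_i}^2=\mathrm{Var}(L_i)$, $\sigma_n^2:=\sum_{i=1}^n\sigma_{L_i}^2$, and let $T_n:=\sum_{i=1}^n L_i$ be the total loss of the first $n$ policies. 1. Suppose that $E(L_i^2)<\infty$ for all $i$, that $\sigma_{L_i}^2>0$ for at least one $i$, and that the Lindeberg condition holds: for every $\varepsilon>0$, $$\frac1{\sigma_n^2}\sum_{i=1}^n E\left[(L_i-\mu_{L_i})^2\,\mathbf 1_{\{|L_i-\mu_{L_i}|>\varepsilon\sigma_n\}}\right]\longrightarrow 0\qquad(n\to\infty).$$ Then $$\frac{1}{\sigma_n}\left(T_n-\sum_{i=1}^n\mu_{L_i}\right)\stackrel{\mathcal D}{\longrightarrow}\mathcal N(0,1).$$ 2. Suppose that the policies follow the joint copula model, that is, there are $\mu_i>0$, $\lambda_i>0$, a common $\delta>0$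 and a bivariate copula $C$ such that, for every $i$, $X_i$ has the Gamma distribution with mean $\mu_i$ and variance $\mu_i^2\delta$, $Y_i$ has the zero-truncated Poisson distribution $P(Y_i=y)=\frac{\lambda_i^y e^{-\lambda_i}}{y!\,(1-e^{-\lambda_i})}$, $y=1,2,\ldots$, and $P(X_i\le x,\,Y_i\le y)=C(F_{X_i}(x),F_{Y_i}(y))$ for all $x \in \mathbb{R}$ and $y \in \mathbb{N}$. Then $E(L_i^2)<\infty$ and $\sigma_{L_i}^2>0$ for all $i$; and if moreover no single policy dominates the portfolio, i.e. $\max_{i\le n}\sigma_{L_i}^2/\sigma_n^2\to 0$ as $n\to\infty$, then again $$\frac{1}{\sigma_n}\left(T_n-\sum_{i=1}^n\mu_{L_i}\right)\stackrel{\mathcal D}{\longrightarrow}\mathcal N(0,1).$$ -/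

import Mathlib

open MeasureTheory ProbabilityTheory Filter Topology

noncomputable section

/-- The policy loss `L_i = X_i * Y_i` of the `i`-th policy, with average claim size `X_i` and
number of claims `Y_i`. -/
def policyLoss {Ω : Type*} (X : ℕ → Ω → ℝ) (Y : ℕ → Ω → ℕ) (i : ℕ) (ω : Ω) : ℝ :=
  X i ω * (Y i ω : ℝ)

/-- The total loss of the first `n` policies. -/
def totalLoss {Ω : Type*} (X : ℕ → Ω → ℝ) (Y : ℕ → Ω → ℕ) (n : ℕ) (ω : Ω) : ℝ :=
  ∑ i ∈ Finset.range n, policyLoss X Y i ω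

/-- `σ_n = √(∑_{i < n} Var L_i)`, for a sequence `L` of random variables. -/
def sumStdDev {Ω : Type*} [MeasurableSpace Ω] (P : Measure Ω) (L : ℕ → Ω → ℝ) (n : ℕ) : ℝ :=
  √(∑ i ∈ Finset.range n, Var[L i; P])

/-- The Lindeberg condition for a sequence `L` of random variables. -/
def LindebergCondition {Ω : Type*} [MeasurableSpace Ω] (P : Measure Ω) (L : ℕ → Ω → ℝ) : Prop :=
  ∀ ε : ℝ, 0 < ε →
    Tendsto (fun n : ℕ ↦
      (∑ i ∈ Finset.range n,
        ∫ ω in {ω | ε * sumStdDev P L n < |L i ω - ∫ ω', L i ω' ∂P|},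
          (L i ω - ∫ ω', L i ω' ∂P) ^ 2 ∂P) / (sumStdDev P L n) ^ 2)
      atTop (𝓝 0)

/-- `∑_{i < n} L_i`, centred at its mean and divided by `σ_n`, converges in distribution to
`N(0,1)`; here `S n` is the sum of the first `n` terms of `L`. -/
def AsymptoticallyStdNormal {Ω : Type*} [MeasurableSpace Ω] (P : Measure Ω)
    [IsProbabilityMeasure P] (L : ℕ → Ω → ℝ) (S : ℕ → Ω → ℝ) : Prop :=
  TendstoInDistribution
    (fun (n : ℕ) (ω : Ω) ↦
      (S n ω - ∑ i ∈ Finset.range n, ∫ ω', L i ω' ∂P) / sumStdDev P L n)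
    atTop (id : ℝ → ℝ) (fun _ ↦ P) (gaussianReal 0 1)

/-- A bivariate copula: on the unit square, `C` is the joint distribution function of a probability
measure on the plane both of whose margins are uniform on `[0,1]`. -/
def IsCopula (C : ℝ → ℝ → ℝ) : Prop :=
  ∃ ν : Measure (ℝ × ℝ), IsProbabilityMeasure ν ∧
    ν.map Prod.fst = volume.restrict (Set.Icc (0 : ℝ) 1) ∧
    ν.map Prod.snd = volume.restrict (Set.Icc (0 : ℝ) 1) ∧
    ∀ u ∈ Set.Icc (0 : ℝ) 1, ∀ v ∈ Set.Icc (0 : ℝ) 1,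
      C u v = ν.real (Set.Iic u ×ˢ Set.Iic v)

/-- The Gamma distribution with mean `μ` and dispersion `δ`: shape `1/δ` and rate `1/(μδ)`, so that
the variance is `μ²δ`. -/
def gammaMeanDisp (μ δ : ℝ) : Measure ℝ := gammaMeasure (1 / δ) (1 / (μ * δ))

/-- The zero-truncated Poisson distribution: mass `λ^y e^{-λ} / (y! (1 - e^{-λ}))` at
`y = 1, 2, …`. -/
def ztpMeasure (lam : ℝ) : Measure ℕ :=
  Measure.sum fun y : ℕ ↦
    ENNReal.ofReal
      (if y = 0 then 0
        else lam ^ y * Real.exp (-lam) / ((y.factorial : ℝ) * (1 - Real.exp (-lam)))) •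
      Measure.dirac y

/-- The joint copula model: the average claim size `X` is Gamma distributed with mean `μ` and
dispersion `δ`, the number of claims `Y` is zero-truncated Poisson with parameter `lam`, and the
joint distribution function of `(X, Y)` is `C (F_X x) (F_Y y)`. -/
structure IsJointCopulaModel {Ω : Type*} [MeasurableSpace Ω] (P : Measure Ω)
    (X : Ω → ℝ) (Y : Ω → ℕ) (μ δ lam : ℝ) (C : ℝ → ℝ → ℝ) : Prop where
  hasLaw_size : HasLaw X (gammaMeanDisp μ δ) P
  hasLaw_number : HasLaw Y (ztpMeasure lam) P
  joint_cdf : ∀ (x : ℝ) (y : ℕ),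
    P.real {ω | X ω ≤ x ∧ Y ω ≤ y} =
      C ((gammaMeanDisp μ δ).real (Set.Iic x)) ((ztpMeasure lam).real (Set.Iic y))

end

/-! The first claim is Lindeberg's theorem, proved with characteristic functions. Each centred,
normalized summand has characteristic function close to `1 - u i`, hence to `exp (-u i)`, where `u
i` is its share of `t ^ 2 / 2`. The product of these exponentials is exactly the Gaussian one, and
the product of the errors is controlled by their sum, which the Lindeberg ratio makes small
(`norm_charFun_normalized_sum_sub_exp_le`).

For the copula model it suffices that the losses have uniformly bounded kurtosis: together with
negligible individual variances this gives the Lindeberg condition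
(`lindebergCondition_of_kurtosis_le`). Kurtosis is invariant under scaling, and dividing the claim
size by its mean leaves one Gamma law `G` common to all policies, so only the Poisson parameter
varies. With `s = max 1 lam`, the fourth moment of the product is at most of order `s ^ 4`, and its
variance is at least of order `s ^ 2`. For large `lam` this holds because `Y / lam` concentrates at
`1`; for bounded `lam` because `G` has a density and `Y` takes few values with most of its mass.
These bounds rest on the marginal laws alone, so they hold under every dependence between size and
number. -/

/-! ### Elementary complex estimates. -/

theorem norm_prod_sub_prod_le_sum {ι : Type*} (s : Finset ι) (a b : ι → ℂ)
    (ha : ∀ i ∈ s, ‖a i‖ ≤ 1) (hb : ∀ i ∈ s, ‖b i‖ ≤ 1) :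
    ‖∏ i ∈ s, a i - ∏ i ∈ s, b i‖ ≤ ∑ i ∈ s, ‖a i - b i‖ := by
  classical
  induction s using Finset.induction_on with
  | empty => simp
  | insert j s hj ih =>
    rw [Finset.prod_insert hj, Finset.prod_insert hj, Finset.sum_insert hj]
    have ih' := ih (fun i hi ↦ ha i (Finset.mem_insert_of_mem hi))
      (fun i hi ↦ hb i (Finset.mem_insert_of_mem hi))
    have h1 : ‖∏ i ∈ s, a i‖ ≤ 1 := by
      rw [norm_prod]
      exact Finset.prod_le_one (fun _ _ ↦ norm_nonneg _)
        (fun i hi ↦ ha i (Finset.mem_insert_of_mem hi))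
    have h2 := hb j (Finset.mem_insert_self j s)
    calc ‖a j * ∏ i ∈ s, a i - b j * ∏ i ∈ s, b i‖
        = ‖(a j - b j) * ∏ i ∈ s, a i + b j * (∏ i ∈ s, a i - ∏ i ∈ s, b i)‖ := by
          congr 1; ring
      _ ≤ ‖a j - b j‖ * ‖∏ i ∈ s, a i‖ + ‖b j‖ * ‖∏ i ∈ s, a i - ∏ i ∈ s, b i‖ := by
          rw [← norm_mul, ← norm_mul]; exact norm_add_le _ _
      _ ≤ ‖a j - b j‖ * 1 + 1 * ∑ i ∈ s, ‖a i - b i‖ := by gcongr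
      _ = _ := by ring

/-- The cubic bound serves where the variable is small, the quadratic one on the tail, where only
second moments are available. The constant is crude: `e < 4` for `|x| ≤ 1`, and the triangle
inequality otherwise. -/
theorem norm_exp_mul_I_sub_taylor_le (x : ℝ) :
    ‖Complex.exp (x * Complex.I) - (1 + x * Complex.I - x ^ 2 / 2)‖ ≤ 4 * |x| ^ 3 ∧
      ‖Complex.exp (x * Complex.I) - (1 + x * Complex.I - x ^ 2 / 2)‖ ≤ 4 * x ^ 2 := by
  have hx0 := abs_nonneg x
  rw [← sq_abs x]
  rcases le_total |x| 1 with h | h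
  · have h1 := Complex.norm_exp_sub_sum_le_norm_mul_exp (x * Complex.I) 3
    have h2 : ∑ m ∈ Finset.range 3, (x * Complex.I) ^ m / (m.factorial : ℂ) =
        1 + x * Complex.I - x ^ 2 / 2 := by
      simp [Finset.sum_range_succ, mul_pow, Nat.factorial]
      ring
    rw [h2] at h1
    have h3 : ‖(x : ℂ) * Complex.I‖ = |x| := by simp
    rw [h3] at h1
    have h4 : Real.exp |x| ≤ 4 := by
      have := Real.exp_le_exp.2 h
      linarith [Real.exp_one_lt_d9]
    have h5 : ‖Complex.exp (x * Complex.I) - (1 + x * Complex.I - x ^ 2 / 2)‖ ≤ 4 * |x| ^ 3 := by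
      refine h1.trans ?_
      rw [mul_comm]
      gcongr
    refine ⟨h5, h5.trans ?_⟩
    gcongr 4 * ?_
    exact pow_le_pow_of_le_one hx0 h (by norm_num)
  · have h5 : ‖Complex.exp (x * Complex.I) - (1 + x * Complex.I - x ^ 2 / 2)‖ ≤ 4 * |x| ^ 2 := by
      calc _ ≤ ‖Complex.exp (x * Complex.I)‖ + ‖(1 + x * Complex.I - x ^ 2 / 2 : ℂ)‖ :=
            norm_sub_le _ _
        _ ≤ 1 + (‖(1 : ℂ)‖ + ‖(x : ℂ) * Complex.I‖ + ‖(x : ℂ) ^ 2 / 2‖) := by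
            gcongr
            · rw [Complex.norm_exp_ofReal_mul_I]
            · exact (norm_sub_le _ _).trans (by gcongr; exact norm_add_le _ _)
        _ = 1 + (1 + |x| + |x| ^ 2 / 2) := by simp
        _ ≤ 4 * |x| ^ 2 := by nlinarith
    refine ⟨h5.trans ?_, h5⟩
    gcongr 4 * ?_
    exact pow_le_pow_right₀ h (by norm_num)

theorem norm_exp_neg_sub_one_sub_le {u : ℝ} (hu : 0 ≤ u) :
    ‖(1 - u : ℂ) - Complex.exp (-u)‖ ≤ u ^ 2 := by
  have : (1 - u : ℂ) - Complex.exp (-u) = ((1 - u - Real.exp (-u) : ℝ) : ℂ) := by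
    push_cast; rfl
  rw [this, Complex.norm_real, Real.norm_eq_abs, abs_le]
  have h1 := Real.add_one_le_exp (-u)
  have h2 := Real.add_one_le_exp u
  have h3 : Real.exp (-u) * Real.exp u = 1 := by rw [← Real.exp_add]; simp
  have h4 := Real.exp_pos (-u)
  constructor
  · have h5 : Real.exp (-u) * (u + 1) ≤ 1 :=
      (mul_le_mul_of_nonneg_left h2 h4.le).trans_eq h3
    have h6 : Real.exp (-u) ≤ 1 / (u + 1) := by rwa [le_div_iff₀ (by positivity)]
    have h7 : 1 / (u + 1) ≤ 1 - u + u ^ 2 := by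
      rw [div_le_iff₀ (by positivity)]
      nlinarith [pow_nonneg hu 3]
    linarith
  · nlinarith

/-! ### Lindeberg's theorem by characteristic functions. -/

section Lindeberg

variable {Ω : Type*} [MeasurableSpace Ω] {P : Measure Ω}

theorem nullMeasurableSet_lt_abs {Z : Ω → ℝ} (hZ : AEMeasurable Z P) (c : ℝ) :
    NullMeasurableSet {ω | c < |Z ω|} P :=
  nullMeasurableSet_lt aemeasurable_const (by fun_prop)

/-- The quantity that the Lindeberg condition asks to tend to zero. -/
noncomputable def lindebergRatio (P : Measure Ω) (L : ℕ → Ω → ℝ) (ε : ℝ) (n : ℕ) : ℝ :=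
  (∑ i ∈ Finset.range n,
    ∫ ω in {ω | ε * sumStdDev P L n < |L i ω - ∫ ω', L i ω' ∂P|},
      (L i ω - ∫ ω', L i ω' ∂P) ^ 2 ∂P) / (sumStdDev P L n) ^ 2

theorem sq_sumStdDev (L : ℕ → Ω → ℝ) (n : ℕ) :
    sumStdDev P L n ^ 2 = ∑ i ∈ Finset.range n, Var[L i; P] :=
  Real.sq_sqrt (Finset.sum_nonneg fun _ _ ↦ variance_nonneg _ _)

theorem eventually_sumStdDev_pos {L : ℕ → Ω → ℝ} (hpos : ∃ i, 0 < Var[L i; P]) :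
    ∀ᶠ n in atTop, 0 < sumStdDev P L n := by
  obtain ⟨i, hi⟩ := hpos
  filter_upwards [eventually_gt_atTop i] with n hn
  refine Real.sqrt_pos.2 (hi.trans_le ?_)
  exact Finset.single_le_sum (f := fun i ↦ Var[L i; P]) (fun _ _ ↦ variance_nonneg _ _)
    (Finset.mem_range.2 hn)

variable [IsProbabilityMeasure P]

/-- Second order expansion of the characteristic function of a centred square integrable variable,
with an error controlled by a truncation at level `ε`. -/
theorem norm_charFun_sub_one_sub_le {Z : Ω → ℝ} (hZ : MemLp Z 2 P) (h0 : ∫ ω, Z ω ∂P = 0)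
    (t ε : ℝ) (hε : 0 ≤ ε) :
    ‖charFun (P.map Z) t - (1 - (t ^ 2 * (∫ ω, Z ω ^ 2 ∂P) / 2 : ℝ))‖ ≤
      4 * ε * |t| ^ 3 * ∫ ω, Z ω ^ 2 ∂P + 4 * t ^ 2 * ∫ ω in {ω | ε < |Z ω|}, Z ω ^ 2 ∂P := by
  have hm : AEMeasurable Z P := hZ.aemeasurable
  have hi1 : Integrable Z P := hZ.integrable (by norm_num)
  have hi2 : Integrable (fun ω ↦ Z ω ^ 2) P := hZ.integrable_sq
  have hs := nullMeasurableSet_lt_abs hm ε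
  have hi1c : Integrable (fun ω ↦ ((t * Z ω : ℝ) : ℂ)) P := (hi1.const_mul t).ofReal
  have hi2c : Integrable (fun ω ↦ ((t ^ 2 * Z ω ^ 2 / 2 : ℝ) : ℂ)) P :=
    ((hi2.const_mul (t ^ 2)).div_const 2).ofReal
  have hie : Integrable (fun ω ↦ Complex.exp ((t * Z ω : ℝ) * Complex.I)) P := by
    refine Integrable.of_bound (C := 1) (by fun_prop) (ae_of_all _ fun ω ↦ ?_)
    rw [Complex.norm_exp_ofReal_mul_I]
  have hlin : Integrable (fun ω ↦ 1 + ((t * Z ω : ℝ) : ℂ) * Complex.I) P :=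
    (integrable_const _).add (hi1c.mul_const _)
  have hquad : Integrable
      (fun ω ↦ 1 + ((t * Z ω : ℝ) : ℂ) * Complex.I - ((t ^ 2 * Z ω ^ 2 / 2 : ℝ) : ℂ)) P :=
    hlin.sub hi2c
  have hchar : charFun (P.map Z) t = ∫ ω, Complex.exp ((t * Z ω : ℝ) * Complex.I) ∂P := by
    rw [charFun_apply_real, integral_map hm (by fun_prop)]
    simp
  have hpoly : (1 - (t ^ 2 * (∫ ω, Z ω ^ 2 ∂P) / 2 : ℝ) : ℂ) =
      ∫ ω, (1 + ((t * Z ω : ℝ) : ℂ) * Complex.I - ((t ^ 2 * Z ω ^ 2 / 2 : ℝ) : ℂ)) ∂P := by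
    rw [integral_sub hlin hi2c,
      integral_add (integrable_const _) (hi1c.mul_const _), integral_mul_const,
      integral_complex_ofReal, integral_complex_ofReal, integral_const_mul, h0, integral_div,
      integral_const_mul]
    simp
  rw [hchar, hpoly, ← integral_sub hie hquad]
  have hind : Integrable ({ω | ε < |Z ω|}.indicator fun ω ↦ Z ω ^ 2) P := hi2.indicator₀ hs
  calc _ ≤ ∫ ω, (4 * ε * |t| ^ 3 * Z ω ^ 2 +
        4 * t ^ 2 * {ω | ε < |Z ω|}.indicator (fun ω ↦ Z ω ^ 2) ω) ∂P := by
        refine norm_integral_le_of_norm_le ((hi2.const_mul _).add (hind.const_mul _))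
          (ae_of_all _ fun ω ↦ ?_)
        obtain ⟨hA, hB⟩ := norm_exp_mul_I_sub_taylor_le (t * Z ω)
        have hE : ‖Complex.exp ((t * Z ω : ℝ) * Complex.I) -
            (1 + ((t * Z ω : ℝ) : ℂ) * Complex.I - ((t ^ 2 * Z ω ^ 2 / 2 : ℝ) : ℂ))‖ =
            ‖Complex.exp ((t * Z ω : ℝ) * Complex.I) -
            (1 + ((t * Z ω : ℝ) : ℂ) * Complex.I - ((t * Z ω : ℝ) : ℂ) ^ 2 / 2)‖ := by
          congr 3; push_cast; ring
        rw [hE]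
        by_cases h : ω ∈ {ω | ε < |Z ω|}
        · rw [Set.indicator_of_mem h]
          refine hB.trans ?_
          have : 0 ≤ 4 * ε * |t| ^ 3 * Z ω ^ 2 := by positivity
          nlinarith
        · rw [Set.indicator_of_notMem h]
          have h' : |Z ω| ≤ ε := by simpa using h
          refine hA.trans ?_
          rw [abs_mul, mul_pow, pow_succ |Z ω| 2, sq_abs]
          have : 0 ≤ 4 * |t| ^ 3 * Z ω ^ 2 := by positivity
          nlinarith
    _ = _ := by
        rw [integral_add (hi2.const_mul _) (hind.const_mul _), integral_const_mul,
          integral_const_mul, integral_indicator₀ hs]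

/-- With `c = ε * σ` this shows that the Lindeberg condition forces every single variance to be
negligible against `σ ^ 2`, which controls the error of replacing `1 - u` by `exp (-u)`. -/
theorem integral_sq_le_sq_add_setIntegral {Z : Ω → ℝ} (hZ : MemLp Z 2 P) (c : ℝ) :
    ∫ ω, Z ω ^ 2 ∂P ≤ c ^ 2 + ∫ ω in {ω | c < |Z ω|}, Z ω ^ 2 ∂P := by
  have hs := nullMeasurableSet_lt_abs hZ.aemeasurable c
  have hi2 : Integrable (fun ω ↦ Z ω ^ 2) P := hZ.integrable_sq
  have hind : Integrable ({ω | c < |Z ω|}.indicator fun ω ↦ Z ω ^ 2) P := hi2.indicator₀ hs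
  calc _ ≤ ∫ ω, (c ^ 2 + {ω | c < |Z ω|}.indicator (fun ω ↦ Z ω ^ 2) ω) ∂P := by
        refine integral_mono hi2 ((integrable_const _).add hind) fun ω ↦ ?_
        by_cases h : ω ∈ {ω | c < |Z ω|}
        · simp only [Set.indicator_of_mem h]
          nlinarith
        · have h' : |Z ω| ≤ c := by simpa using h
          simp only [Set.indicator_of_notMem h, add_zero]
          exact sq_le_sq' (by linarith [neg_abs_le (Z ω)]) ((le_abs_self _).trans h')
    _ = _ := by
        rw [integral_add (integrable_const _) hind, integral_indicator₀ hs]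
        simp

theorem norm_charFun_normalized_sum_sub_exp_le {L : ℕ → Ω → ℝ} (hL : iIndepFun L P)
    (h2 : ∀ i, MemLp (L i) 2 P) {n : ℕ} (hn : 0 < sumStdDev P L n) (t : ℝ) {ε : ℝ} (hε : 0 ≤ ε) :
    ‖charFun (P.map fun ω ↦ (∑ i ∈ Finset.range n, L i ω -
        ∑ i ∈ Finset.range n, ∫ ω', L i ω' ∂P) / sumStdDev P L n) t -
      Complex.exp (-(t ^ 2 / 2 : ℝ))‖ ≤
      4 * ε * |t| ^ 3 + 4 * t ^ 2 * lindebergRatio P L ε n +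
        t ^ 4 / 4 * (ε ^ 2 + lindebergRatio P L ε n) := by
  set σ := sumStdDev P L n with hσ
  set Z : ℕ → Ω → ℝ := fun i ω ↦ L i ω - ∫ ω', L i ω' ∂P with hZdef
  set J : ℕ → ℝ := fun i ↦ ∫ ω in {ω | ε * σ < |Z i ω|}, Z i ω ^ 2 ∂P with hJdef
  have hZ2 (i) : MemLp (Z i) 2 P := (h2 i).sub (memLp_const _)
  have hZ0 (i) : ∫ ω, Z i ω ∂P = 0 := by
    simp only [hZdef]
    rw [integral_sub ((h2 i).integrable (by norm_num)) (integrable_const _)]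
    simp
  have hv (i) : ∫ ω, Z i ω ^ 2 ∂P = Var[L i; P] := (variance_eq_integral (h2 i).aemeasurable).symm
  have hv0 (i) : 0 ≤ Var[L i; P] := variance_nonneg _ _
  have hsum : ∑ i ∈ Finset.range n, Var[L i; P] = σ ^ 2 := (sq_sumStdDev L n).symm
  have hR : lindebergRatio P L ε n = (∑ i ∈ Finset.range n, J i) / σ ^ 2 := rfl
  have hJ0 (i) : 0 ≤ J i := integral_nonneg fun _ ↦ sq_nonneg _
  have hZind : iIndepFun Z P := hL.comp (fun i x ↦ x - ∫ ω', L i ω' ∂P) (by fun_prop)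
  have hchar : charFun (P.map fun ω ↦ (∑ i ∈ Finset.range n, L i ω -
        ∑ i ∈ Finset.range n, ∫ ω', L i ω' ∂P) / σ) t =
      ∏ i ∈ Finset.range n, charFun (P.map (Z i)) (σ⁻¹ * t) := by
    have : (fun ω ↦ (∑ i ∈ Finset.range n, L i ω -
        ∑ i ∈ Finset.range n, ∫ ω', L i ω' ∂P) / σ) =
        fun ω ↦ σ⁻¹ * ∑ i ∈ Finset.range n, Z i ω := by
      ext ω
      rw [← Finset.sum_sub_distrib, div_eq_inv_mul]
    rw [this, charFun_map_mul_comp, (hZind.restrict _).charFun_map_fun_finsetSum_eq_prod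
      (fun i _ ↦ (hZ2 i).aemeasurable)]
    · simp
    · exact Finset.aemeasurable_fun_sum _ fun i _ ↦ (hZ2 i).aemeasurable
  -- These add up to exactly `t ^ 2 / 2` over `i < n`.
  set u : ℕ → ℝ := fun i ↦ (σ⁻¹ * t) ^ 2 * Var[L i; P] / 2 with hu
  have hu0 (i) : 0 ≤ u i := by have := hv0 i; simp only [hu]; positivity
  have hexp : Complex.exp (-(t ^ 2 / 2 : ℝ)) = ∏ i ∈ Finset.range n, Complex.exp (-(u i : ℝ)) := by
    rw [← Complex.exp_sum, Finset.sum_neg_distrib, ← Complex.ofReal_sum]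
    congr 3
    simp only [hu]
    rw [← Finset.sum_div, ← Finset.mul_sum, hsum]
    field_simp
  have hterm (i) (hi : i ∈ Finset.range n) :
      ‖charFun (P.map (Z i)) (σ⁻¹ * t) - Complex.exp (-(u i : ℝ))‖ ≤
      4 * ε * |t| ^ 3 * (Var[L i; P] / σ ^ 2) + 4 * t ^ 2 * (J i / σ ^ 2) +
        t ^ 4 / 4 * (ε ^ 2 + lindebergRatio P L ε n) * (Var[L i; P] / σ ^ 2) := by
    have h1 := norm_charFun_sub_one_sub_le (hZ2 i) (hZ0 i) (σ⁻¹ * t) (ε * σ) (by positivity)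
    rw [hv] at h1
    have h3 := norm_exp_neg_sub_one_sub_le (hu0 i)
    have h4 := integral_sq_le_sq_add_setIntegral (hZ2 i) (ε * σ)
    rw [hv] at h4
    have h5 : J i ≤ ∑ i ∈ Finset.range n, J i :=
      Finset.single_le_sum (fun i _ ↦ hJ0 i) hi
    have h6 : Var[L i; P] / σ ^ 2 ≤ ε ^ 2 + lindebergRatio P L ε n := by
      rw [hR, div_le_iff₀ (by positivity), add_mul, div_mul_cancel₀ _ (by positivity), ← mul_pow]
      exact h4.trans (by gcongr)
    have h7 : u i ^ 2 ≤ t ^ 4 / 4 * (ε ^ 2 + lindebergRatio P L ε n) * (Var[L i; P] / σ ^ 2) := by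
      have : u i ^ 2 = t ^ 4 / 4 * (Var[L i; P] / σ ^ 2) * (Var[L i; P] / σ ^ 2) := by
        simp only [hu]; field_simp; norm_num
      rw [this]
      have := hv0 i
      gcongr
    calc _ = ‖(charFun (P.map (Z i)) (σ⁻¹ * t) - (1 - (u i : ℝ))) +
          ((1 - (u i : ℝ)) - Complex.exp (-(u i : ℝ)))‖ := by congr 1; ring
      _ ≤ _ := norm_add_le _ _
      _ ≤ (4 * (ε * σ) * |σ⁻¹ * t| ^ 3 * Var[L i; P] + 4 * (σ⁻¹ * t) ^ 2 * J i) +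
          t ^ 4 / 4 * (ε ^ 2 + lindebergRatio P L ε n) * (Var[L i; P] / σ ^ 2) :=
        add_le_add h1 (h3.trans h7)
      _ = _ := by
        rw [abs_mul, abs_inv, abs_of_pos hn]
        field_simp
  rw [hchar, hexp]
  refine (norm_prod_sub_prod_le_sum _ _ _ (fun i _ ↦ ?_) (fun i _ ↦ ?_)).trans
    ((Finset.sum_le_sum hterm).trans_eq ?_)
  · have := Measure.isProbabilityMeasure_map (hZ2 i).aemeasurable
    exact norm_charFun_le_one _
  · rw [← Complex.ofReal_neg, Complex.norm_exp_ofReal]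
    exact Real.exp_le_one_iff.2 (by linarith [hu0 i])
  · rw [Finset.sum_add_distrib, Finset.sum_add_distrib, ← Finset.mul_sum, ← Finset.mul_sum,
      ← Finset.mul_sum, ← Finset.sum_div, ← Finset.sum_div, hsum, ← hR, div_self (by positivity)]
    ring

/-- **Lindeberg's central limit theorem.** -/
theorem asymptoticallyStdNormal_of_lindebergCondition {L : ℕ → Ω → ℝ} (hL : iIndepFun L P)
    (h2 : ∀ i, MemLp (L i) 2 P) (hpos : ∃ i, 0 < Var[L i; P]) (hLin : LindebergCondition P L) :
    AsymptoticallyStdNormal P L fun n ω ↦ ∑ i ∈ Finset.range n, L i ω where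
  forall_aemeasurable n :=
    ((Finset.aemeasurable_fun_sum _ fun i _ ↦ (h2 i).aemeasurable).sub_const _).div_const _
  tendsto := by
    refine ProbabilityMeasure.tendsto_iff_tendsto_charFun.2 fun t ↦ ?_
    simp only [ProbabilityMeasure.coe_mk, Measure.map_id, charFun_gaussianReal]
    have hlim : Complex.exp (t * (0 : ℝ) * Complex.I - (1 : NNReal) * t ^ 2 / 2) =
        Complex.exp (-(t ^ 2 / 2 : ℝ)) := by
      congr 1; push_cast; ring
    simp only [hlim]
    rw [Metric.tendsto_nhds]
    intro η hη
    -- Once the Lindeberg ratio is below `ε ≤ 1`, also `ε ^ 2 ≤ ε`, and the whole error is at most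
    -- `ε * K`; the summand `1` keeps `K` positive at `t = 0`.
    set K : ℝ := 4 * |t| ^ 3 + 4 * t ^ 2 + t ^ 4 / 2 + 1 with hK
    have hK0 : 0 < K := by positivity
    set ε : ℝ := min 1 (η / (2 * K)) with hεd
    have hε : 0 < ε := by positivity
    have hε1 : ε ≤ 1 := min_le_left _ _
    have hεK : ε * K < η := by
      have : ε ≤ η / (2 * K) := min_le_right _ _
      calc ε * K ≤ η / (2 * K) * K := by gcongr
        _ = η / 2 := by field_simp
        _ < η := by linarith
    have hlt : ∀ᶠ n in atTop, lindebergRatio P L ε n < ε := (hLin ε hε).eventually_lt_const hε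
    filter_upwards [hlt, eventually_sumStdDev_pos hpos] with n hn hσ
    rw [dist_eq_norm]
    refine (norm_charFun_normalized_sum_sub_exp_le hL h2 hσ t hε.le).trans_lt (lt_of_le_of_lt ?_ hεK)
    have hsq : ε ^ 2 ≤ ε := by nlinarith
    calc _ ≤ 4 * ε * |t| ^ 3 + 4 * t ^ 2 * ε + t ^ 4 / 4 * (ε + ε) := by gcongr
      _ ≤ ε * K := by rw [hK]; nlinarith

end Lindeberg

/-! ### From bounded kurtosis to the Lindeberg condition. -/

section Lyapunov

variable {Ω : Type*} [MeasurableSpace Ω] {P : Measure Ω}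

theorem MeasureTheory.MemLp.integrable_pow_four {Z : Ω → ℝ} (hZ : MemLp Z 4 P) :
    Integrable (fun ω ↦ Z ω ^ 4) P := by
  have h := hZ.integrable_norm_pow (p := 4) (by norm_num)
  refine h.congr (ae_of_all _ fun ω ↦ ?_)
  simp only [Real.norm_eq_abs]
  exact (by decide : Even 4).pow_abs _

variable [IsProbabilityMeasure P]

/-- Markov's argument: on the truncation set, `c ^ 2 * Z ^ 2 ≤ Z ^ 4`. -/
theorem sq_mul_setIntegral_sq_le {Z : Ω → ℝ} (hZ : MemLp Z 4 P) {c : ℝ} (hc : 0 ≤ c) :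
    c ^ 2 * ∫ ω in {ω | c < |Z ω|}, Z ω ^ 2 ∂P ≤ ∫ ω, Z ω ^ 4 ∂P := by
  have hs := nullMeasurableSet_lt_abs hZ.aemeasurable c
  have hZ2 : MemLp Z 2 P := hZ.mono_exponent (by norm_num)
  have hi2 : Integrable (fun ω ↦ Z ω ^ 2) P := hZ2.integrable_sq
  rw [← integral_indicator₀ hs, ← integral_const_mul]
  refine integral_mono ((hi2.indicator₀ hs).const_mul _) hZ.integrable_pow_four fun ω ↦ ?_
  by_cases h : ω ∈ {ω | c < |Z ω|}
  · have h' : c < |Z ω| := h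
    have h2 : c ^ 2 ≤ Z ω ^ 2 := by rw [← sq_abs (Z ω)]; gcongr
    simp only [Set.indicator_of_mem h]
    nlinarith [sq_nonneg (Z ω)]
  · simp only [Set.indicator_of_notMem h, mul_zero]
    positivity

/-- If the fourth central moments are bounded by a fixed multiple of the squared variances, and no
variance dominates the sum, then the Lindeberg condition holds. -/
theorem lindebergCondition_of_kurtosis_le {L : ℕ → Ω → ℝ} (h4 : ∀ i, MemLp (L i) 4 P)
    (hpos : ∃ i, 0 < Var[L i; P]) {K : ℝ} (hK0 : 0 < K)
    (hK : ∀ i, ∫ ω, (L i ω - ∫ ω', L i ω' ∂P) ^ 4 ∂P ≤ K * Var[L i; P] ^ 2)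
    (hdom : ∀ ε : ℝ, 0 < ε → ∀ᶠ n : ℕ in atTop, ∀ i < n,
      Var[L i; P] ≤ ε * ∑ j ∈ Finset.range n, Var[L j; P]) :
    LindebergCondition P L := by
  intro ε hε
  rw [Metric.tendsto_nhds]
  intro η hη
  filter_upwards [hdom (ε ^ 2 * η / (2 * K)) (by positivity), eventually_sumStdDev_pos hpos]
    with n hn hσ
  set σ := sumStdDev P L n with hσd
  have hsum : ∑ j ∈ Finset.range n, Var[L j; P] = σ ^ 2 := (sq_sumStdDev L n).symm
  rw [hsum] at hn
  have hterm : ∀ i ∈ Finset.range n, ∫ ω in {ω | ε * σ < |L i ω - ∫ ω', L i ω' ∂P|},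
      (L i ω - ∫ ω', L i ω' ∂P) ^ 2 ∂P ≤ η / 2 * Var[L i; P] := by
    intro i hi
    have h1 := sq_mul_setIntegral_sq_le ((h4 i).sub (memLp_const (∫ ω', L i ω' ∂P)))
      (c := ε * σ) (by positivity)
    simp only [Pi.sub_apply] at h1
    have h2 := h1.trans (hK i)
    have h3 := hn i (Finset.mem_range.1 hi)
    have h5 := variance_nonneg (L i) P
    refine le_of_mul_le_mul_left (h2.trans ?_) (by positivity : 0 < (ε * σ) ^ 2)
    calc K * Var[L i; P] ^ 2 = K * Var[L i; P] * Var[L i; P] := by ring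
      _ ≤ K * (ε ^ 2 * η / (2 * K) * σ ^ 2) * Var[L i; P] := by gcongr
      _ = (ε * σ) ^ 2 * (η / 2 * Var[L i; P]) := by field_simp
  have h0 : 0 ≤ ∑ i ∈ Finset.range n, ∫ ω in {ω | ε * σ < |L i ω - ∫ ω', L i ω' ∂P|},
      (L i ω - ∫ ω', L i ω' ∂P) ^ 2 ∂P :=
    Finset.sum_nonneg fun i _ ↦ integral_nonneg fun _ ↦ sq_nonneg _
  rw [Real.dist_0_eq_abs, abs_of_nonneg (by positivity), div_lt_iff₀ (by positivity)]
  calc _ ≤ ∑ i ∈ Finset.range n, η / 2 * Var[L i; P] := Finset.sum_le_sum hterm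
    _ = η / 2 * σ ^ 2 := by rw [← Finset.mul_sum, hsum]
    _ < η * σ ^ 2 := by have : 0 < σ ^ 2 := by positivity
                        nlinarith

end Lyapunov

/-! ### Scaling and moments of the Gamma law. -/

section Gamma

theorem gammaPDFReal_div {a r c : ℝ} (hr : 0 < r) (hc : 0 < c) (x : ℝ) :
    gammaPDFReal a (r / c) x = c⁻¹ * gammaPDFReal a r (c⁻¹ * x) := by
  have h : 0 ≤ c⁻¹ * x ↔ 0 ≤ x := by
    constructor
    · intro h; by_contra! hx
      exact absurd h (not_le.2 (mul_neg_of_pos_of_neg (by positivity) hx))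
    · intro h; positivity
  simp only [gammaPDFReal, h]
  split_ifs with hx
  · have h1 : c⁻¹ ^ a = c⁻¹ * c⁻¹ ^ (a - 1) := by
      rw [Real.rpow_sub_one (by positivity)]; field_simp
    have h2 : c⁻¹ * r * x = r * (c⁻¹ * x) := by ring
    rw [div_eq_inv_mul r c, Real.mul_rpow (by positivity) hr.le,
      Real.mul_rpow (by positivity) hx, h1, h2]
    ring
  · simp

theorem map_mul_gammaMeasure {a r c : ℝ} (hr : 0 < r) (hc : 0 < c) :
    (gammaMeasure a (r / c)).map (c⁻¹ * ·) = gammaMeasure a r := by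
  ext s hs
  have hm : Measurable fun x : ℝ ↦ c⁻¹ * x := by fun_prop
  have hpdf : Measurable (gammaPDF a r) := (measurable_gammaPDFReal a r).ennreal_ofReal
  rw [Measure.map_apply hm hs, gammaMeasure, gammaMeasure, withDensity_apply _ (hm hs),
    withDensity_apply _ hs, ← lintegral_indicator (hm hs), ← lintegral_indicator hs]
  have h1 : ∀ x, ((c⁻¹ * ·) ⁻¹' s).indicator (gammaPDF a (r / c)) x =
      ENNReal.ofReal c⁻¹ * s.indicator (gammaPDF a r) (c⁻¹ * x) := by
    intro x
    by_cases hx : c⁻¹ * x ∈ s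
    · rw [Set.indicator_of_mem hx, Set.indicator_of_mem (by exact hx), gammaPDF, gammaPDF,
        gammaPDFReal_div hr hc, ENNReal.ofReal_mul (by positivity)]
    · rw [Set.indicator_of_notMem hx, Set.indicator_of_notMem (by exact hx), mul_zero]
  simp_rw [h1]
  rw [lintegral_const_mul' _ _ ENNReal.ofReal_ne_top, ← lintegral_map (hpdf.indicator hs) hm]
  conv_rhs => rw [← Real.smul_map_volume_mul_left (a := c⁻¹) (by positivity)]
  rw [lintegral_smul_measure, abs_of_pos (by positivity), smul_eq_mul]

/-- On the half line, `x ^ n` times the density of shape `a` is a constant times the density of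
shape `a + n`. -/
theorem integrable_pow_gammaMeasure {a r : ℝ} (ha : 0 < a) (hr : 0 < r) (n : ℕ) :
    Integrable (fun x ↦ x ^ n) (gammaMeasure a r) := by
  have hpdf : Measurable (gammaPDF a r) := (measurable_gammaPDFReal a r).ennreal_ofReal
  refine ⟨by fun_prop, ?_⟩
  have han : 0 < a + n := by positivity
  rw [hasFiniteIntegral_iff_enorm, gammaMeasure, lintegral_withDensity_eq_lintegral_mul _ hpdf
    (by fun_prop)]
  have h : ∀ x : ℝ, (gammaPDF a r * fun x : ℝ ↦ ‖x ^ n‖ₑ) x =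
      ENNReal.ofReal (Real.Gamma (a + n) / Real.Gamma a / r ^ n) * gammaPDF (a + n) r x := by
    intro x
    have hG := Real.Gamma_pos_of_pos ha
    have hG' := Real.Gamma_pos_of_pos han
    rw [Pi.mul_apply, ← ofReal_norm, gammaPDF, gammaPDF, ← ENNReal.ofReal_mul
      (gammaPDFReal_nonneg ha hr x), ← ENNReal.ofReal_mul (by positivity)]
    congr 1
    simp only [gammaPDFReal]
    split_ifs with hx
    -- The origin is separate because real powers add in the exponent only for a positive base; `a =
    -- 1` matters there since `0 ^ 0 = 1`.
    · rcases hx.eq_or_lt with rfl | hx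
      · rcases Nat.eq_zero_or_pos n with rfl | hn
        · simp; field_simp
        · rcases eq_or_ne a 1 with rfl | ha1
          · simp [hn.ne']
          · have h3 : a + n - 1 ≠ 0 := by
              have : (1 : ℝ) ≤ n := by exact_mod_cast hn
              linarith
            simp [hn.ne', h3]
      · rw [Real.norm_of_nonneg (by positivity), show a + n - 1 = (a - 1) + n by ring,
          Real.rpow_add hx, Real.rpow_add hr, Real.rpow_natCast, Real.rpow_natCast]
        field_simp
    · simp
  simp_rw [h]
  rw [lintegral_const_mul' _ _ ENNReal.ofReal_ne_top,
    lintegral_gammaPDF_eq_one han hr, mul_one]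
  exact ENNReal.ofReal_lt_top

theorem gammaMeasure_absolutelyContinuous (a r : ℝ) : gammaMeasure a r ≪ volume :=
  withDensity_absolutelyContinuous _ _

end Gamma

/-! ### Exponential moments and concentration of the zero-truncated Poisson law. -/

section ZeroTruncatedPoisson

variable {Ω : Type*} [MeasurableSpace Ω] {P : Measure Ω} {Y : Ω → ℕ} {lam : ℝ}

theorem lintegral_ztpMeasure (f : ℕ → ENNReal) :
    ∫⁻ y, f y ∂(ztpMeasure lam) = ∑' y : ℕ, ENNReal.ofReal
      (if y = 0 then 0
        else lam ^ y * Real.exp (-lam) / ((y.factorial : ℝ) * (1 - Real.exp (-lam)))) * f y := by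
  rw [ztpMeasure, lintegral_sum_measure]
  simp

theorem ae_ne_zero_of_hasLaw_ztpMeasure (hY : HasLaw Y (ztpMeasure lam) P) : ∀ᵐ ω ∂P, Y ω ≠ 0 := by
  rw [hY.ae_iff (p := fun y ↦ y ≠ 0) measurable_from_nat, ae_iff, ← lintegral_indicator_one
    (MeasurableSet.of_discrete), lintegral_ztpMeasure, ENNReal.tsum_eq_zero]
  intro y
  rcases eq_or_ne y 0 with rfl | hy <;> simp [*]

theorem lintegral_exp_of_hasLaw_ztpMeasure (hlam : 0 < lam) (hY : HasLaw Y (ztpMeasure lam) P)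
    (t : ℝ) :
    ∫⁻ ω, ENNReal.ofReal (Real.exp (t * Y ω)) ∂P =
      ENNReal.ofReal ((Real.exp (lam * Real.exp t) - 1) / (Real.exp lam - 1)) := by
  have hE : 0 < Real.exp lam - 1 := by
    have := Real.add_one_lt_exp hlam.ne'; linarith
  have hE' : 0 < 1 - Real.exp (-lam) := by
    have := Real.exp_lt_one_iff.2 (neg_lt_zero.2 hlam); linarith
  rw [hY.lintegral_comp (f := fun y : ℕ ↦ ENNReal.ofReal (Real.exp (t * y)))
    measurable_from_nat.aemeasurable, lintegral_ztpMeasure]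
  have hs : HasSum (fun y : ℕ ↦ (lam * Real.exp t) ^ y / (y.factorial : ℝ))
      (Real.exp (lam * Real.exp t)) := by
    rw [Real.exp_eq_exp_ℝ]; exact NormedSpace.expSeries_div_hasSum_exp _
  -- Truncation at zero removes the constant term of the exponential series.
  have hs' := ((hs.update 0 0).div_const (Real.exp lam - 1))
  have hterm : ∀ y : ℕ, (if y = 0 then 0
        else lam ^ y * Real.exp (-lam) / ((y.factorial : ℝ) * (1 - Real.exp (-lam)))) *
        Real.exp (t * y) =
      Function.update (fun y : ℕ ↦ (lam * Real.exp t) ^ y / (y.factorial : ℝ)) 0 0 y /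
        (Real.exp lam - 1) := by
    intro y
    rcases eq_or_ne y 0 with rfl | hy
    · simp
    · have h1 : Real.exp (t * y) = Real.exp t ^ y := by
        rw [mul_comm, Real.exp_nat_mul]
      have h2 : Real.exp (-lam) / (1 - Real.exp (-lam)) = 1 / (Real.exp lam - 1) := by
        rw [Real.exp_neg] at hE' ⊢
        field_simp
      rw [Function.update_of_ne hy, if_neg hy, h1, mul_pow]
      calc _ = lam ^ y * Real.exp t ^ y / (y.factorial : ℝ) *
            (Real.exp (-lam) / (1 - Real.exp (-lam))) := by field_simp
        _ = _ := by rw [h2]; ring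
  have hnn : ∀ y : ℕ, 0 ≤ (if y = 0 then 0
        else lam ^ y * Real.exp (-lam) / ((y.factorial : ℝ) * (1 - Real.exp (-lam)))) := by
    intro y; split_ifs <;> positivity
  simp_rw [← fun y : ℕ ↦ ENNReal.ofReal_mul (q := Real.exp (t * y)) (hnn y)]
  rw [← ENNReal.ofReal_tsum_of_nonneg]
  · simp_rw [hterm, hs'.tsum_eq]
    simp
    ring_nf
  · exact fun y ↦ mul_nonneg (hnn y) (Real.exp_pos _).le
  · simp_rw [hterm]; exact hs'.summable

theorem integrable_exp_of_hasLaw_ztpMeasure (hlam : 0 < lam) (hY : HasLaw Y (ztpMeasure lam) P)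
    (t : ℝ) : Integrable (fun ω ↦ Real.exp (t * Y ω)) P := by
  have hm : AEMeasurable (fun ω ↦ (Y ω : ℝ)) P :=
    measurable_from_nat.comp_aemeasurable hY.aemeasurable
  refine ⟨AEMeasurable.aestronglyMeasurable (by fun_prop), ?_⟩
  rw [hasFiniteIntegral_iff_ofReal (ae_of_all _ fun ω ↦ (Real.exp_pos _).le),
    lintegral_exp_of_hasLaw_ztpMeasure hlam hY]
  exact ENNReal.ofReal_lt_top

theorem integral_exp_of_hasLaw_ztpMeasure (hlam : 0 < lam) (hY : HasLaw Y (ztpMeasure lam) P)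
    (t : ℝ) : ∫ ω, Real.exp (t * Y ω) ∂P =
      (Real.exp (lam * Real.exp t) - 1) / (Real.exp lam - 1) := by
  have hE : 0 < Real.exp lam - 1 := by
    have := Real.add_one_lt_exp hlam.ne'; linarith
  have hE' : 0 ≤ Real.exp (lam * Real.exp t) - 1 := by
    have := Real.add_one_le_exp (lam * Real.exp t)
    have : 0 < lam * Real.exp t := by positivity
    linarith
  rw [integral_eq_lintegral_of_nonneg_ae (ae_of_all _ fun ω ↦ (Real.exp_pos _).le)
    (integrable_exp_of_hasLaw_ztpMeasure hlam hY t).aestronglyMeasurable,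
    lintegral_exp_of_hasLaw_ztpMeasure hlam hY, ENNReal.toReal_ofReal (by positivity)]

/-- Since `exp lam ≥ 2`, subtracting `1` at most halves the denominator. -/
theorem exp_sub_one_div_le {x lam : ℝ} (hlam : 1 ≤ lam) :
    (Real.exp x - 1) / (Real.exp lam - 1) ≤ 2 * Real.exp (x - lam) := by
  have h := Real.add_one_le_exp lam
  have hx := Real.exp_pos x
  rw [div_le_iff₀ (by linarith), Real.exp_sub]
  have : 2 * (Real.exp x / Real.exp lam) * (Real.exp lam - 1) =
      Real.exp x * (2 * (Real.exp lam - 1) / Real.exp lam) := by field_simp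
  rw [this]
  have h2 : 1 ≤ 2 * (Real.exp lam - 1) / Real.exp lam := by
    rw [le_div_iff₀ (Real.exp_pos _)]; linarith
  nlinarith

theorem exp_le_one_add_add_sq {t : ℝ} (ht : |t| ≤ 1) : Real.exp t ≤ 1 + t + t ^ 2 := by
  have h := Real.norm_exp_sub_one_sub_id_le (x := t) ht
  rw [Real.norm_eq_abs, Real.norm_eq_abs, sq_abs] at h
  linarith [(abs_le.1 h).2]

/-- A bound for the moment generating function of a zero-truncated Poisson variable, uniform over
the parameter, at the inverse of `max 1 lam`. -/
theorem integral_exp_div_max_le (hlam : 0 < lam) (hY : HasLaw Y (ztpMeasure lam) P) :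
    ∫ ω, Real.exp ((max 1 lam)⁻¹ * Y ω) ∂P ≤ 2 * Real.exp 2 + Real.exp (1 + Real.exp 1) := by
  rw [integral_exp_of_hasLaw_ztpMeasure hlam hY]
  rcases le_total 1 lam with h | h
  · rw [max_eq_right h]
    refine (exp_sub_one_div_le h).trans ?_
    have h1 : lam⁻¹ ≤ 1 := inv_le_one_of_one_le₀ h
    have h2 := exp_le_one_add_add_sq (t := lam⁻¹) (by rwa [abs_of_pos (by positivity)])
    have h3 : lam * Real.exp lam⁻¹ - lam ≤ 2 := by
      calc lam * Real.exp lam⁻¹ - lam ≤ lam * (1 + lam⁻¹ + lam⁻¹ ^ 2) - lam := by gcongr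
        _ = 1 + lam⁻¹ := by field_simp; ring
        _ ≤ 2 := by linarith
    have := Real.exp_pos (1 + Real.exp 1)
    have := Real.exp_le_exp.2 h3
    linarith
  · rw [max_eq_left h, inv_one]
    have h1 := Real.add_one_lt_exp hlam.ne'
    have h2 : Real.exp (lam * Real.exp 1) - 1 ≤
        lam * Real.exp 1 * Real.exp (lam * Real.exp 1) := by
      have h3 := Real.add_one_le_exp (-(lam * Real.exp 1))
      have h4 : Real.exp (-(lam * Real.exp 1)) * Real.exp (lam * Real.exp 1) = 1 := by
        rw [← Real.exp_add]; simp
      nlinarith [Real.exp_pos (lam * Real.exp 1)]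
    have h5 : Real.exp (lam * Real.exp 1) ≤ Real.exp (Real.exp 1) :=
      Real.exp_le_exp.2 (mul_le_of_le_one_left (Real.exp_pos _).le h)
    have h6 : (Real.exp (lam * Real.exp 1) - 1) / (Real.exp lam - 1) ≤
        Real.exp (1 + Real.exp 1) := by
      rw [div_le_iff₀ (by linarith), Real.exp_add]
      calc _ ≤ lam * Real.exp 1 * Real.exp (lam * Real.exp 1) := h2
        _ ≤ lam * Real.exp 1 * Real.exp (Real.exp 1) := by gcongr
        _ = Real.exp 1 * Real.exp (Real.exp 1) * lam := by ring
        _ ≤ _ := by gcongr; linarith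
    have := Real.exp_pos 2
    linarith

theorem integrable_pow_of_hasLaw_ztpMeasure (hlam : 0 < lam) (hY : HasLaw Y (ztpMeasure lam) P)
    (n : ℕ) : Integrable (fun ω ↦ (Y ω : ℝ) ^ n) P := by
  have hm : AEMeasurable (fun ω ↦ (Y ω : ℝ)) P :=
    measurable_from_nat.comp_aemeasurable hY.aemeasurable
  refine ((integrable_exp_of_hasLaw_ztpMeasure hlam hY 1).const_mul (n.factorial : ℝ)).mono'
    (AEMeasurable.aestronglyMeasurable (by fun_prop)) (ae_of_all _ fun ω ↦ ?_)
  have h := Real.pow_div_factorial_le_exp (Y ω : ℝ) (by positivity) n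
  rw [Real.norm_of_nonneg (by positivity), one_mul]
  rwa [div_le_iff₀ (by positivity), mul_comm] at h

theorem integral_div_max_pow_le (hlam : 0 < lam) (hY : HasLaw Y (ztpMeasure lam) P) (n : ℕ) :
    ∫ ω, ((Y ω : ℝ) / max 1 lam) ^ n ∂P ≤
      n.factorial * (2 * Real.exp 2 + Real.exp (1 + Real.exp 1)) := by
  have hs : 0 < max 1 lam := lt_max_of_lt_left one_pos
  refine le_trans ?_ (mul_le_mul_of_nonneg_left (integral_exp_div_max_le hlam hY) (by positivity))
  rw [← integral_const_mul]
  refine integral_mono ?_ ((integrable_exp_of_hasLaw_ztpMeasure hlam hY _).const_mul _)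
    fun ω ↦ ?_
  · simp_rw [div_pow]
    exact (integrable_pow_of_hasLaw_ztpMeasure hlam hY n).div_const _
  · have h := Real.pow_div_factorial_le_exp ((Y ω : ℝ) / max 1 lam) (by positivity) n
    rw [div_le_iff₀ (by positivity), mul_comm] at h
    simpa [div_eq_inv_mul] using h

/-- A Chernoff bound at the scale of the standard deviation, `t = ± 1 / √lam`: the exponent `lam *
(exp t - 1 - t)` is at most `lam * t ^ 2 = 1`. -/
theorem exp_neg_mul_integral_exp_le (hlam : 1 ≤ lam) (hY : HasLaw Y (ztpMeasure lam) P) {t : ℝ}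
    (ht : t ^ 2 * lam = 1) : Real.exp (-(t * lam)) * ∫ ω, Real.exp (t * Y ω) ∂P ≤
      2 * Real.exp 1 := by
  have ht1 : |t| ≤ 1 := by
    rw [← sq_le_one_iff_abs_le_one]
    nlinarith [sq_nonneg t]
  rw [integral_exp_of_hasLaw_ztpMeasure (by linarith) hY]
  calc _ ≤ Real.exp (-(t * lam)) * (2 * Real.exp (lam * Real.exp t - lam)) := by
        gcongr; exact exp_sub_one_div_le hlam
    _ = 2 * Real.exp (lam * (Real.exp t - 1 - t)) := by
        rw [mul_left_comm, ← Real.exp_add]; ring_nf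
    _ ≤ 2 * Real.exp (lam * t ^ 2) := by
        gcongr; linarith [exp_le_one_add_add_sq ht1]
    _ = _ := by rw [mul_comm, mul_comm lam, ht]; ring

/-- The fourth moment of the relative deviation of a zero-truncated Poisson variable from its
parameter. -/
theorem integral_relative_deviation_pow_four_le (hlam : 1 ≤ lam)
    (hY : HasLaw Y (ztpMeasure lam) P) :
    Integrable (fun ω ↦ (((Y ω : ℝ) - lam) / lam) ^ 4) P ∧
    ∫ ω, (((Y ω : ℝ) - lam) / lam) ^ 4 ∂P ≤ 96 * Real.exp 1 / lam ^ 2 := by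
  have hl : 0 < lam := by linarith
  have hm : AEMeasurable (fun ω ↦ (Y ω : ℝ)) P :=
    measurable_from_nat.comp_aemeasurable hY.aemeasurable
  set t : ℝ := (√lam)⁻¹ with htd
  have ht0 : 0 < t := by positivity
  have ht : t ^ 2 * lam = 1 := by
    rw [htd, inv_pow, Real.sq_sqrt hl.le]; field_simp
  have hI (u : ℝ) := integrable_exp_of_hasLaw_ztpMeasure hl hY u
  have hB : ∀ ω, (((Y ω : ℝ) - lam) / lam) ^ 4 ≤
      24 / lam ^ 2 * (Real.exp (-(t * lam)) * Real.exp (t * Y ω) +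
        Real.exp (-(-t * lam)) * Real.exp (-t * Y ω)) := by
    intro ω
    set z : ℝ := t * (Y ω - lam) with hz
    have h1 := Real.pow_div_factorial_le_exp |z| (abs_nonneg z) 4
    rw [(by decide : Even 4).pow_abs] at h1
    have h2 : Real.exp |z| ≤ Real.exp z + Real.exp (-z) := by
      rcases abs_cases z with ⟨h, _⟩ | ⟨h, _⟩ <;> rw [h] <;>
        linarith [Real.exp_pos z, Real.exp_pos (-z)]
    have h3 : (((Y ω : ℝ) - lam) / lam) ^ 4 = z ^ 4 / lam ^ 2 := by
      have h4 : t ^ 2 = lam⁻¹ := eq_inv_of_mul_eq_one_left ht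
      have h5 : t ^ 4 = (lam⁻¹) ^ 2 := by rw [← h4]; ring
      rw [hz, mul_pow, h5]; field_simp
    have h6 : Real.exp (-(t * lam)) * Real.exp (t * Y ω) = Real.exp z := by
      rw [← Real.exp_add, hz]; ring_nf
    have h7 : Real.exp (-(-t * lam)) * Real.exp (-t * Y ω) = Real.exp (-z) := by
      rw [← Real.exp_add, hz]; ring_nf
    have h8 : z ^ 4 ≤ 24 * (Real.exp z + Real.exp (-z)) := by
      have : ((Nat.factorial 4 : ℕ) : ℝ) = 24 := by norm_num [Nat.factorial]
      rw [this] at h1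
      linarith
    rw [h3, h6, h7, div_mul_eq_mul_div]
    gcongr
  have hint : Integrable (fun ω ↦ 24 / lam ^ 2 * (Real.exp (-(t * lam)) * Real.exp (t * Y ω) +
        Real.exp (-(-t * lam)) * Real.exp (-t * Y ω))) P :=
    (((hI t).const_mul _).add ((hI (-t)).const_mul _)).const_mul _
  have hint4 : Integrable (fun ω ↦ (((Y ω : ℝ) - lam) / lam) ^ 4) P :=
    hint.mono' (AEMeasurable.aestronglyMeasurable (by fun_prop)) (ae_of_all _ fun ω ↦ by
      rw [Real.norm_of_nonneg (by positivity)]; exact hB ω)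
  refine ⟨hint4, (integral_mono hint4 hint hB).trans ?_⟩
  rw [integral_const_mul, integral_add ((hI t).const_mul _) ((hI (-t)).const_mul _),
    integral_const_mul, integral_const_mul]
  have h1 := exp_neg_mul_integral_exp_le hlam hY ht
  have h2 := exp_neg_mul_integral_exp_le hlam hY (t := -t) (by rw [neg_sq]; exact ht)
  calc _ ≤ 24 / lam ^ 2 * (2 * Real.exp 1 + 2 * Real.exp 1) := by gcongr
    _ = _ := by ring

end ZeroTruncatedPoisson

/-! ### Moment and variance bounds for products of dependent variables. -/

section Moments

variable {Ω : Type*} [MeasurableSpace Ω] {P : Measure Ω}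

theorem memLp_four_of_integrable {Z : Ω → ℝ} (hm : AEMeasurable Z P)
    (h : Integrable (fun ω ↦ Z ω ^ 4) P) : MemLp Z 4 P := by
  rw [← integrable_norm_rpow_iff hm.aestronglyMeasurable (by norm_num) (by norm_num)]
  refine h.congr (ae_of_all _ fun ω ↦ ?_)
  have : (4 : ENNReal).toReal = ((4 : ℕ) : ℝ) := by norm_num
  simp only [this, Real.rpow_natCast, Real.norm_eq_abs]
  exact ((by decide : Even 4).pow_abs _).symm

theorem memLp_four_mul {X Y : Ω → ℝ} (hXm : AEMeasurable X P) (hYm : AEMeasurable Y P)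
    (hX : Integrable (fun ω ↦ X ω ^ 8) P) (hY : Integrable (fun ω ↦ Y ω ^ 8) P) :
    MemLp (fun ω ↦ X ω * Y ω) 4 P := by
  refine memLp_four_of_integrable (by fun_prop) ((hX.add hY).mono'
    (AEMeasurable.aestronglyMeasurable (by fun_prop)) (ae_of_all _ fun ω ↦ ?_))
  rw [Real.norm_of_nonneg (by positivity)]
  simp only [Pi.add_apply]
  nlinarith [sq_nonneg (X ω ^ 4 - Y ω ^ 4), sq_nonneg (X ω ^ 4), sq_nonneg (Y ω ^ 4)]

/-- The factors may be dependent, so the product is split by `x ^ 4 * y ^ 4 ≤ x ^ 8 + y ^ 8`, at the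
price of eighth moments. -/
theorem integral_mul_pow_four_le {X Y : Ω → ℝ} {s : ℝ} (hs : 0 < s)
    (hXm : AEMeasurable X P) (hYm : AEMeasurable Y P)
    (hX : Integrable (fun ω ↦ X ω ^ 8) P) (hY : Integrable (fun ω ↦ Y ω ^ 8) P) :
    ∫ ω, (X ω * Y ω) ^ 4 ∂P ≤ s ^ 4 * (∫ ω, X ω ^ 8 ∂P + ∫ ω, (Y ω / s) ^ 8 ∂P) := by
  have hY' : Integrable (fun ω ↦ (Y ω / s) ^ 8) P := by
    simp_rw [div_pow]; exact hY.div_const _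
  rw [← integral_add hX hY', ← integral_const_mul]
  refine integral_mono (memLp_four_mul hXm hYm hX hY).integrable_pow_four
    ((hX.add hY').const_mul _) fun ω ↦ ?_
  have h1 : (X ω * Y ω) ^ 4 = s ^ 4 * (X ω ^ 4 * (Y ω / s) ^ 4) := by field_simp
  simp only [h1]
  gcongr
  nlinarith [sq_nonneg (X ω ^ 4 - (Y ω / s) ^ 4), sq_nonneg (X ω ^ 4), sq_nonneg ((Y ω / s) ^ 4)]

variable [IsProbabilityMeasure P]

/-- Convexity gives `(Z - m) ^ 4 ≤ 8 * Z ^ 4 + 8 * m ^ 4`, and Jensen, applied twice as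
nonnegativity of a variance, bounds `m ^ 4` by the fourth moment. -/
theorem integral_sub_mean_pow_four_le {Z : Ω → ℝ} (hZ : MemLp Z 4 P) :
    ∫ ω, (Z ω - ∫ ω', Z ω' ∂P) ^ 4 ∂P ≤ 16 * ∫ ω, Z ω ^ 4 ∂P := by
  set m := ∫ ω', Z ω' ∂P with hm
  have hZ2 : MemLp Z 2 P := hZ.mono_exponent (by norm_num)
  have hi4 := hZ.integrable_pow_four
  have h1 : m ^ 2 ≤ ∫ ω, Z ω ^ 2 ∂P := by
    have := variance_nonneg Z P
    rw [variance_eq_sub hZ2] at this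
    simpa using this
  have hsq : MemLp (fun ω ↦ Z ω ^ 2) 2 P := by
    rw [memLp_two_iff_integrable_sq (hZ.aemeasurable.pow_const 2).aestronglyMeasurable]
    refine hi4.congr (ae_of_all _ fun ω ↦ ?_)
    simp only; ring
  have h2 : (∫ ω, Z ω ^ 2 ∂P) ^ 2 ≤ ∫ ω, Z ω ^ 4 ∂P := by
    have := variance_nonneg (fun ω ↦ Z ω ^ 2) P
    rw [variance_eq_sub hsq] at this
    have h3 : ∫ ω, ((fun ω ↦ Z ω ^ 2) ^ 2) ω ∂P = ∫ ω, Z ω ^ 4 ∂P := by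
      congr 1; ext ω; simp only [Pi.pow_apply]; ring
    linarith
  have h3 : m ^ 4 ≤ ∫ ω, Z ω ^ 4 ∂P := by
    calc m ^ 4 = (m ^ 2) ^ 2 := by ring
      _ ≤ (∫ ω, Z ω ^ 2 ∂P) ^ 2 := by gcongr
      _ ≤ _ := h2
  calc _ ≤ ∫ ω, (8 * Z ω ^ 4 + 8 * m ^ 4) ∂P := by
        refine integral_mono (hZ.sub (memLp_const m)).integrable_pow_four
          ((hi4.const_mul _).add (integrable_const _)) fun ω ↦ ?_
        simp only
        have h5 : (Z ω - m) ^ 2 ≤ 2 * (Z ω ^ 2 + m ^ 2) := by nlinarith [sq_nonneg (Z ω + m)]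
        have h6 : (Z ω ^ 2 + m ^ 2) ^ 2 ≤ 2 * (Z ω ^ 4 + m ^ 4) := by
          nlinarith [sq_nonneg (Z ω ^ 2 - m ^ 2)]
        calc (Z ω - m) ^ 4 = ((Z ω - m) ^ 2) ^ 2 := by ring
          _ ≤ (2 * (Z ω ^ 2 + m ^ 2)) ^ 2 := by gcongr
          _ ≤ _ := by linarith
    _ = 8 * ∫ ω, Z ω ^ 4 ∂P + 8 * m ^ 4 := by
        rw [integral_add (hi4.const_mul _) (integrable_const _), integral_const_mul]
        simp
    _ ≤ _ := by linarith

theorem variance_le_integral_sub_sq {Z : Ω → ℝ} (hZ : AEMeasurable Z P) (c : ℝ) :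
    Var[Z; P] ≤ ∫ ω, (Z ω - c) ^ 2 ∂P := by
  rw [← variance_sub_const hZ.aestronglyMeasurable c]
  exact variance_le_expectation_sq (hZ.sub_const c).aestronglyMeasurable

/-- If `Y / s` is close to `1`, then the variance of `X * Y` is at least of the order of
`s ^ 2 * Var X`. -/
theorem variance_le_two_mul_variance_mul_div_add {X Y : Ω → ℝ} {s a : ℝ} (hs : 0 < s) (ha : 0 < a)
    (hXm : AEMeasurable X P) (hXY : MemLp (fun ω ↦ X ω * Y ω) 2 P)
    (hX : Integrable (fun ω ↦ X ω ^ 4) P)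
    (hY : Integrable (fun ω ↦ ((Y ω - s) / s) ^ 4) P) :
    Var[X; P] ≤ 2 * Var[fun ω ↦ X ω * Y ω; P] / s ^ 2 +
      (a * ∫ ω, X ω ^ 4 ∂P + a⁻¹ * ∫ ω, ((Y ω - s) / s) ^ 4 ∂P) := by
  set m := ∫ ω', X ω' * Y ω' ∂P with hm
  have hi : Integrable (fun ω ↦ (X ω * Y ω - m) ^ 2) P := (hXY.sub (memLp_const m)).integrable_sq
  have hR : Integrable (fun ω ↦ 2 / s ^ 2 * (X ω * Y ω - m) ^ 2 +
      (a * X ω ^ 4 + a⁻¹ * ((Y ω - s) / s) ^ 4)) P :=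
    (hi.const_mul _).add ((hX.const_mul _).add (hY.const_mul _))
  have hR' : Integrable (fun ω ↦ a * X ω ^ 4 + a⁻¹ * ((Y ω - s) / s) ^ 4) P :=
    (hX.const_mul _).add (hY.const_mul _)
  have hpt : ∀ ω, (X ω - m / s) ^ 2 ≤ 2 / s ^ 2 * (X ω * Y ω - m) ^ 2 +
      (a * X ω ^ 4 + a⁻¹ * ((Y ω - s) / s) ^ 4) := by
    intro ω
    set z := (Y ω - s) / s with hz
    -- The centre `m / s` need not be the mean of `X`; the mean only lowers the mean square. The
    -- cross term `X * z` is then split by a weighted AM-GM with weight `a`.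
    have h1 : X ω - m / s = (X ω * Y ω - m) / s - X ω * z := by rw [hz]; field_simp; ring
    set q := (X ω * Y ω - m) / s with hq
    have h2 : 2 / s ^ 2 * (X ω * Y ω - m) ^ 2 = 2 * q ^ 2 := by rw [hq]; field_simp
    have h3 : 2 * (X ω * z) ^ 2 ≤ a * X ω ^ 4 + a⁻¹ * z ^ 4 := by
      have h4 : a * X ω ^ 4 + a⁻¹ * z ^ 4 - 2 * (X ω * z) ^ 2 =
          a⁻¹ * (a * X ω ^ 2 - z ^ 2) ^ 2 := by field_simp; ring
      have : 0 ≤ a⁻¹ * (a * X ω ^ 2 - z ^ 2) ^ 2 := by positivity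
      linarith
    rw [h1, h2]
    nlinarith [sq_nonneg (q + X ω * z)]
  refine (variance_le_integral_sub_sq hXm (m / s)).trans ?_
  calc _ ≤ ∫ ω, (2 / s ^ 2 * (X ω * Y ω - m) ^ 2 +
      (a * X ω ^ 4 + a⁻¹ * ((Y ω - s) / s) ^ 4)) ∂P :=
        integral_mono (hR.mono' (AEMeasurable.aestronglyMeasurable (by fun_prop))
          (ae_of_all _ fun ω ↦ by rw [Real.norm_of_nonneg (by positivity)]; exact hpt ω)) hR hpt
    _ = _ := by
        rw [integral_add (hi.const_mul _) hR',
          integral_add (hX.const_mul _) (hY.const_mul _), integral_const_mul, integral_const_mul,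
          integral_const_mul, variance_eq_integral hXY.aemeasurable]
        ring

/-- Chebyshev's inequality, as a lower bound for the variance. -/
theorem sq_div_two_le_variance {Z : Ω → ℝ} (hZ : MemLp Z 2 P) {η : ℝ} (hη : 0 < η)
    (h : P {ω | |Z ω - ∫ ω', Z ω' ∂P| < η} ≤ 1 / 2) : η ^ 2 / 2 ≤ Var[Z; P] := by
  have h1 := meas_ge_le_variance_div_sq hZ hη
  have h2 : (1 : ENNReal) ≤ P {ω | η ≤ |Z ω - ∫ ω', Z ω' ∂P|} +
      P {ω | |Z ω - ∫ ω', Z ω' ∂P| < η} := by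
    rw [← measure_univ (μ := P)]
    refine (measure_mono fun ω _ ↦ ?_).trans (measure_union_le _ _)
    exact le_or_gt η |Z ω - ∫ ω', Z ω' ∂P|
  have h3 : (1 : ENNReal) ≤ ENNReal.ofReal (Var[Z; P] / η ^ 2) + ENNReal.ofReal (1 / 2) := by
    refine h2.trans (add_le_add h1 (h.trans_eq ?_))
    rw [ENNReal.ofReal_div_of_pos (by norm_num)]; norm_num
  rw [← ENNReal.ofReal_add (div_nonneg (variance_nonneg _ _) (by positivity)) (by norm_num),
    ENNReal.one_le_ofReal] at h3
  have h4 : 1 / 2 ≤ Var[Z; P] / η ^ 2 := by linarith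
  rw [le_div_iff₀ (by positivity)] at h4
  linarith

end Moments

/-! ### Uniform kurtosis bound for a product with a zero-truncated Poisson factor. -/

section Product

variable {G : Measure ℝ} [IsProbabilityMeasure G]

/-- Absolute continuity of the integral of the density: short intervals have small mass, uniformly
in their centre. -/
theorem exists_measure_ball_le (hG : G ≪ volume) {κ : ENNReal} (hκ : κ ≠ 0) :
    ∃ η : ℝ, 0 < η ∧ ∀ c r : ℝ, r ≤ η → G {x | |x - c| < r} ≤ κ := by
  have hfin : ∫⁻ x, G.rnDeriv volume x ∂volume ≠ ⊤ := by
    rw [Measure.lintegral_rnDeriv hG]; simp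
  obtain ⟨τ, hτ, h⟩ := exists_pos_setLIntegral_lt_of_measure_lt hfin hκ
  obtain ⟨η, hη, hητ⟩ : ∃ η : ℝ, 0 < η ∧ ENNReal.ofReal (2 * η) < τ := by
    obtain ⟨q, hq0, hq⟩ := ENNReal.lt_iff_exists_real_btwn.1 hτ
    refine ⟨q / 2, ?_, ?_⟩
    · have := ENNReal.ofReal_pos.1 hq.1; linarith
    · rw [mul_div_cancel₀ _ (by norm_num)]; exact hq.2
  refine ⟨η, hη, fun c r hr ↦ ?_⟩
  have hball : {x | |x - c| < r} = Metric.ball c r := by ext x; simp [Real.dist_eq]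
  rw [hball, ← Measure.setLIntegral_rnDeriv hG]
  refine (h _ (lt_of_le_of_lt ?_ hητ)).le
  rw [Real.volume_ball]
  exact ENNReal.ofReal_le_ofReal (by linarith)

variable {Ω : Type*} [MeasurableSpace Ω] {P : Measure Ω} [IsProbabilityMeasure P]

theorem variance_id_pos_of_absolutelyContinuous (hG : G ≪ volume) (h2 : MemLp id 2 G) :
    0 < Var[id; G] := by
  refine (variance_nonneg _ _).lt_of_ne' fun h ↦ ?_
  have h3 := ae_eq_integral_of_variance_eq_zero h2 h
  have h4 : ∀ᵐ x ∂G, x ≠ ∫ y, id y ∂G := hG.ae_le (compl_mem_ae_iff.2 (measure_singleton _))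
  obtain ⟨x, hx, hx'⟩ := (h3.and h4).exists
  exact hx' hx

theorem exists_variance_mul_ztp_ge_of_large (hG : G ≪ volume)
    (h8 : Integrable (fun x ↦ x ^ 8) G) :
    ∃ Λ c : ℝ, 1 ≤ Λ ∧ 0 < c ∧ ∀ (lam : ℝ) (X : Ω → ℝ) (Y : Ω → ℕ), Λ ≤ lam → HasLaw X G P →
      HasLaw Y (ztpMeasure lam) P → c * lam ^ 2 ≤ Var[fun ω ↦ X ω * (Y ω : ℝ); P] := by
  have h4 : Integrable (fun x ↦ x ^ 4) G := by
    refine (h8.add (integrable_const 1)).mono' (by fun_prop) (ae_of_all _ fun x ↦ ?_)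
    rw [Real.norm_of_nonneg (by positivity)]
    simp only [Pi.add_apply]
    nlinarith [sq_nonneg (x ^ 4 - 1), sq_nonneg (x ^ 4)]
  have h2 : MemLp id 2 G := (memLp_four_of_integrable aemeasurable_id h4).mono_exponent (by norm_num)
  set D := Var[id; G] with hD
  have hD0 : 0 < D := variance_id_pos_of_absolutelyContinuous hG h2
  set M := ∫ x, x ^ 4 ∂G with hM
  have hM0 : 0 ≤ M := integral_nonneg fun x ↦ by positivity
  -- The two error terms are each to cost at most `D / 4`: the first by this choice of `a`, the
  -- second by taking `lam ≥ 4 * B / D`.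
  set a := D / (4 * (M + 1)) with ha
  have ha0 : 0 < a := by positivity
  have haM : a * M ≤ D / 4 := by
    rw [ha, div_mul_eq_mul_div, div_le_div_iff₀ (by positivity) (by positivity)]
    nlinarith
  set B := a⁻¹ * (96 * Real.exp 1) with hB
  have hB0 : 0 < B := by positivity
  refine ⟨max 1 (4 * B / D), D / 4, le_max_left _ _, by positivity, ?_⟩
  intro lam X Y hlam hX hY
  have hl1 : 1 ≤ lam := (le_max_left _ _).trans hlam
  have hl2 : 4 * B / D ≤ lam := (le_max_right _ _).trans hlam
  have hl0 : 0 < lam := by linarith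
  have hYm : AEMeasurable (fun ω ↦ (Y ω : ℝ)) P :=
    measurable_from_nat.comp_aemeasurable hY.aemeasurable
  have hpow (n : ℕ) (hn : Integrable (fun x ↦ x ^ n) G) : Integrable (fun ω ↦ X ω ^ n) P := by
    rw [← hX.map_eq] at hn
    exact hn.comp_aemeasurable hX.aemeasurable
  obtain ⟨hZi, hZ⟩ := integral_relative_deviation_pow_four_le hl1 hY
  have hXY : MemLp (fun ω ↦ X ω * (Y ω : ℝ)) 2 P :=
    (memLp_four_mul hX.aemeasurable hYm (hpow 8 h8)
      (integrable_pow_of_hasLaw_ztpMeasure hl0 hY 8)).mono_exponent (by norm_num)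
  have key := variance_le_two_mul_variance_mul_div_add hl0 ha0 hX.aemeasurable hXY (hpow 4 h4) hZi
  have hXM : ∫ ω, X ω ^ 4 ∂P = M :=
    hX.integral_comp (f := fun x : ℝ ↦ x ^ 4) (by fun_prop)
  rw [hX.variance_eq, hXM] at key
  have hZ' : a⁻¹ * ∫ ω, (((Y ω : ℝ) - lam) / lam) ^ 4 ∂P ≤ D / 4 := by
    calc _ ≤ a⁻¹ * (96 * Real.exp 1 / lam ^ 2) := by gcongr
      _ = B / lam ^ 2 := by rw [hB]; ring
      _ ≤ D / 4 := by
        rw [div_le_iff₀ hD0] at hl2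
        rw [div_le_div_iff₀ (by positivity) (by norm_num)]
        nlinarith [mul_pos hD0 hl0]
  have h5 : D / 2 ≤ 2 * Var[fun ω ↦ X ω * (Y ω : ℝ); P] / lam ^ 2 := by linarith
  rw [le_div_iff₀ (by positivity)] at h5
  linarith

theorem exists_variance_mul_ztp_ge_of_le (hG : G ≪ volume)
    (h8 : Integrable (fun x ↦ x ^ 8) G) (Λ : ℝ) (hΛ : 1 ≤ Λ) :
    ∃ c : ℝ, 0 < c ∧ ∀ (lam : ℝ) (X : Ω → ℝ) (Y : Ω → ℕ), 0 < lam → lam ≤ Λ → HasLaw X G P →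
      HasLaw Y (ztpMeasure lam) P → c ≤ Var[fun ω ↦ X ω * (Y ω : ℝ); P] := by
  set B := 2 * Real.exp 2 + Real.exp (1 + Real.exp 1) with hB
  have hB0 : 0 < B := by positivity
  -- By Markov, `Y ≥ N` has probability at most `1 / 4`. The remaining `N` cells get mass at most `1
  -- / (4 * N)` each, so the product lies within `η` of its mean with probability at most `1 / 2`.
  obtain ⟨N, hN⟩ := exists_nat_ge (4 * (Λ * B))
  have hN0 : 0 < N := by
    have : (0 : ℝ) < N := lt_of_lt_of_le (by positivity) hN
    exact_mod_cast this
  obtain ⟨η, hη, hball⟩ := exists_measure_ball_le hG (κ := (4 * N : ENNReal)⁻¹)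
    (by simp [ENNReal.mul_eq_top])
  refine ⟨η ^ 2 / 2, by positivity, ?_⟩
  intro lam X Y hl0 hlΛ hX hY
  have hYm : AEMeasurable (fun ω ↦ (Y ω : ℝ)) P :=
    measurable_from_nat.comp_aemeasurable hY.aemeasurable
  have hX8 : Integrable (fun ω ↦ X ω ^ 8) P := by
    rw [← hX.map_eq] at h8
    exact h8.comp_aemeasurable hX.aemeasurable
  have hXY : MemLp (fun ω ↦ X ω * (Y ω : ℝ)) 2 P :=
    (memLp_four_mul hX.aemeasurable hYm hX8
      (integrable_pow_of_hasLaw_ztpMeasure hl0 hY 8)).mono_exponent (by norm_num)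
  refine sq_div_two_le_variance hXY hη ?_
  set m := ∫ ω', X ω' * (Y ω' : ℝ) ∂P with hm
  have hmaxΛ : max 1 lam ≤ Λ := max_le hΛ hlΛ
  have hmax0 : 0 < max 1 lam := lt_max_of_lt_left one_pos
  have htail : P {ω | (N : ℝ) ≤ Y ω} ≤ 1 / 4 := by
    have hi : Integrable (fun ω ↦ (Y ω : ℝ)) P := by
      simpa using integrable_pow_of_hasLaw_ztpMeasure hl0 hY 1
    have h1 := integral_div_max_pow_le hl0 hY 1
    simp only [pow_one, Nat.factorial_one, Nat.cast_one, one_mul] at h1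
    rw [integral_div, div_le_iff₀ hmax0] at h1
    have h2 := mul_meas_ge_le_integral_of_nonneg (ae_of_all _ fun ω ↦ (Y ω).cast_nonneg) hi N
    have h3 : N * P.real {ω | (N : ℝ) ≤ Y ω} ≤ N * (1 / 4) := by
      calc _ ≤ B * max 1 lam := h2.trans h1
        _ ≤ B * Λ := by gcongr
        _ ≤ N * (1 / 4) := by linarith
    have h4 := le_of_mul_le_mul_left h3 (by positivity)
    rw [measureReal_def] at h4
    rw [← ENNReal.ofReal_toReal (measure_ne_top P {ω | (N : ℝ) ≤ Y ω})]
    refine (ENNReal.ofReal_le_ofReal h4).trans_eq ?_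
    rw [ENNReal.ofReal_div_of_pos (by norm_num)]; norm_num
  -- The cell of index `y` stands for `Y = y + 1`. Dividing by `Y ≥ 1` only shrinks the interval, so
  -- the law of `X` alone bounds its mass; `Y = 0` is a null event.
  have hcell : ∀ y ∈ Finset.range N, P {ω | |X ω - m / ((y : ℝ) + 1)| < η / ((y : ℝ) + 1)} ≤
      (4 * N : ENNReal)⁻¹ := by
    intro y _
    rw [hX.measure_eq (p := fun x ↦ |x - m / ((y : ℝ) + 1)| < η / ((y : ℝ) + 1))
      (measurableSet_lt (by fun_prop) (by fun_prop))]
    refine hball _ _ (div_le_self hη.le ?_)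
    have : (0 : ℝ) ≤ y := by positivity
    linarith
  have hsub : {ω | |X ω * (Y ω : ℝ) - m| < η} ⊆ {ω | Y ω = 0} ∪ ({ω | (N : ℝ) ≤ Y ω} ∪
      ⋃ y ∈ Finset.range N, {ω | |X ω - m / ((y : ℝ) + 1)| < η / ((y : ℝ) + 1)}) := by
    intro ω hω
    rcases Nat.eq_zero_or_pos (Y ω) with h0 | h0
    · exact Or.inl h0
    rcases le_or_gt N (Y ω) with h1 | h1
    · exact Or.inr (Or.inl (by exact_mod_cast h1))
    · refine Or.inr (Or.inr ?_)
      obtain ⟨y, hy⟩ := Nat.exists_eq_add_one_of_ne_zero h0.ne'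
      refine Set.mem_biUnion (x := y) (Finset.mem_coe.2 (Finset.mem_range.2 (by omega))) ?_
      have hω' : |X ω * (Y ω : ℝ) - m| < η := hω
      rw [hy] at hω'
      push_cast at hω'
      have hy0 : (0 : ℝ) < (y : ℝ) + 1 := by positivity
      change |X ω - m / ((y : ℝ) + 1)| < η / ((y : ℝ) + 1)
      rw [lt_div_iff₀ hy0]
      calc _ = |(X ω - m / ((y : ℝ) + 1)) * ((y : ℝ) + 1)| := by rw [abs_mul, abs_of_pos hy0]
        _ = |X ω * ((y : ℝ) + 1) - m| := by congr 1; field_simp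
        _ < η := hω'
  have hzero : P {ω | Y ω = 0} = 0 := by
    simpa [ae_iff] using ae_ne_zero_of_hasLaw_ztpMeasure hY
  calc P {ω | |X ω * (Y ω : ℝ) - m| < η} ≤ P {ω | Y ω = 0} + (P {ω | (N : ℝ) ≤ Y ω} +
        ∑ y ∈ Finset.range N, P {ω | |X ω - m / ((y : ℝ) + 1)| < η / ((y : ℝ) + 1)}) :=
        (measure_mono hsub).trans ((measure_union_le _ _).trans (by
          gcongr
          exact (measure_union_le _ _).trans (by gcongr; exact measure_biUnion_finset_le _ _)))
    _ ≤ 0 + (1 / 4 + ∑ y ∈ Finset.range N, (4 * N : ENNReal)⁻¹) := by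
        rw [hzero]; gcongr with y hy; exact hcell y hy
    _ = 1 / 4 + 1 / 4 := by
        rw [zero_add, Finset.sum_const, Finset.card_range, nsmul_eq_mul,
          ENNReal.mul_inv (by simp) (by simp), mul_left_comm,
          ENNReal.mul_inv_cancel (by exact_mod_cast hN0.ne') (by simp), mul_one, one_div]
    _ ≤ 1 / 2 := by
        rw [← two_mul, show (4 : ENNReal) = 2 * 2 by norm_num, one_div,
          ENNReal.mul_inv (by simp) (by simp), ← mul_assoc,
          ENNReal.mul_inv_cancel (by norm_num) (by norm_num), one_mul, one_div]

/-- The kurtosis of `X * Y`, with `X` of a fixed absolutely continuous law and `Y` zero-truncated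
Poisson, is bounded uniformly over the Poisson parameter and over the dependence of `X` and `Y`. -/
theorem exists_kurtosis_mul_ztp_le (hG : G ≪ volume) (h8 : Integrable (fun x ↦ x ^ 8) G) :
    ∃ K : ℝ, 0 < K ∧ ∀ (lam : ℝ) (X : Ω → ℝ) (Y : Ω → ℕ), 0 < lam → HasLaw X G P →
      HasLaw Y (ztpMeasure lam) P → MemLp (fun ω ↦ X ω * (Y ω : ℝ)) 4 P ∧
        0 < Var[fun ω ↦ X ω * (Y ω : ℝ); P] ∧
        ∫ ω, (X ω * (Y ω : ℝ) - ∫ ω', X ω' * (Y ω' : ℝ) ∂P) ^ 4 ∂P ≤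
          K * Var[fun ω ↦ X ω * (Y ω : ℝ); P] ^ 2 := by
  obtain ⟨Λ, c₁, hΛ, hc₁, h₁⟩ := exists_variance_mul_ztp_ge_of_large (P := P) hG h8
  obtain ⟨c₂, hc₂, h₂⟩ := exists_variance_mul_ztp_ge_of_le (P := P) hG h8 Λ hΛ
  set B := 2 * Real.exp 2 + Real.exp (1 + Real.exp 1) with hB
  set M := ∫ x, x ^ 8 ∂G + (Nat.factorial 8 : ℕ) * B with hM
  have hM0 : 0 < M := by
    have : 0 ≤ ∫ x, x ^ 8 ∂G := integral_nonneg fun x ↦ by positivity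
    positivity
  set c := min c₁ (c₂ / Λ ^ 2) with hc
  have hc0 : 0 < c := by positivity
  refine ⟨16 * M / c ^ 2, by positivity, ?_⟩
  intro lam X Y hl hX hY
  have hYm : AEMeasurable (fun ω ↦ (Y ω : ℝ)) P :=
    measurable_from_nat.comp_aemeasurable hY.aemeasurable
  have hX8 : Integrable (fun ω ↦ X ω ^ 8) P := by
    rw [← hX.map_eq] at h8
    exact h8.comp_aemeasurable hX.aemeasurable
  have hY8 := integrable_pow_of_hasLaw_ztpMeasure hl hY 8
  have hmem := memLp_four_mul hX.aemeasurable hYm hX8 hY8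
  set s := max 1 lam with hs
  have hs0 : 0 < s := lt_max_of_lt_left one_pos
  have hlow : c * s ^ 2 ≤ Var[fun ω ↦ X ω * (Y ω : ℝ); P] := by
    rcases le_total Λ lam with h | h
    · have : s = lam := max_eq_right (hΛ.trans h)
      rw [this]
      refine le_trans ?_ (h₁ lam X Y h hX hY)
      gcongr
      exact min_le_left _ _
    · have hsΛ : s ≤ Λ := max_le hΛ h
      refine le_trans ?_ (h₂ lam X Y hl h hX hY)
      calc c * s ^ 2 ≤ c₂ / Λ ^ 2 * Λ ^ 2 := by
            gcongr; exact min_le_right _ _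
        _ = c₂ := by field_simp
  refine ⟨hmem, lt_of_lt_of_le (by positivity) hlow, ?_⟩
  have hup : ∫ ω, (X ω * (Y ω : ℝ)) ^ 4 ∂P ≤ s ^ 4 * M := by
    refine (integral_mul_pow_four_le hs0 hX.aemeasurable hYm hX8 hY8).trans ?_
    have hXM : ∫ ω, X ω ^ 8 ∂P = ∫ x, x ^ 8 ∂G :=
      hX.integral_comp (f := fun x : ℝ ↦ x ^ 8) (by fun_prop)
    rw [hXM, hM]
    gcongr
    exact integral_div_max_pow_le hl hY 8
  refine (integral_sub_mean_pow_four_le hmem).trans ?_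
  calc _ ≤ 16 * (s ^ 4 * M) := by gcongr
    _ = 16 * M / c ^ 2 * (c * s ^ 2) ^ 2 := by field_simp
    _ ≤ _ := by gcongr

end Product

/-! ### Reduction to unit mean and conclusion. -/

/-- The resulting law depends on `δ` only; as the dispersion is common to the portfolio, one
kurtosis constant serves all policies. -/
theorem hasLaw_inv_mul_gammaMeanDisp {Ω : Type*} [MeasurableSpace Ω] {P : Measure Ω} {X : Ω → ℝ}
    {μ δ : ℝ} (hμ : 0 < μ) (hδ : 0 < δ) (hX : HasLaw X (gammaMeanDisp μ δ) P) :
    HasLaw (fun ω ↦ μ⁻¹ * X ω) (gammaMeasure (1 / δ) (1 / δ)) P := by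
  have hr : 1 / (μ * δ) = 1 / δ / μ := by field_simp
  have h : HasLaw (fun x : ℝ ↦ μ⁻¹ * x) (gammaMeasure (1 / δ) (1 / δ)) (gammaMeanDisp μ δ) := by
    refine ⟨by fun_prop, ?_⟩
    unfold gammaMeanDisp
    rw [hr]
    exact map_mul_gammaMeasure (by positivity) hμ
  exact h.fun_comp hX

/-- In a portfolio whose claim sizes are Gamma distributed with a common dispersion and whose claim
numbers are zero-truncated Poisson, the kurtosis of the losses is bounded. -/
theorem exists_kurtosis_policyLoss_le {Ω : Type*} [MeasurableSpace Ω] {P : Measure Ω}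
    [IsProbabilityMeasure P] {X : ℕ → Ω → ℝ} {Y : ℕ → Ω → ℕ} {μ lam : ℕ → ℝ} {δ : ℝ}
    (hμ : ∀ i, 0 < μ i) (hlam : ∀ i, 0 < lam i) (hδ : 0 < δ)
    (hX : ∀ i, HasLaw (X i) (gammaMeanDisp (μ i) δ) P)
    (hY : ∀ i, HasLaw (Y i) (ztpMeasure (lam i)) P) :
    ∃ K : ℝ, 0 < K ∧ ∀ i, MemLp (policyLoss X Y i) 4 P ∧ 0 < Var[policyLoss X Y i; P] ∧
      ∫ ω, (policyLoss X Y i ω - ∫ ω', policyLoss X Y i ω' ∂P) ^ 4 ∂P ≤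
        K * Var[policyLoss X Y i; P] ^ 2 := by
  have hδ' : 0 < 1 / δ := by positivity
  have := isProbabilityMeasure_gammaMeasure hδ' hδ'
  obtain ⟨K, hK0, hK⟩ := exists_kurtosis_mul_ztp_le (P := P)
    (gammaMeasure_absolutelyContinuous (1 / δ) (1 / δ)) (integrable_pow_gammaMeasure hδ' hδ' 8)
  refine ⟨K, hK0, fun i ↦ ?_⟩
  obtain ⟨h1, h2, h3⟩ := hK (lam i) _ (Y i) (hlam i)
    (hasLaw_inv_mul_gammaMeanDisp (hμ i) hδ (hX i)) (hY i)
  have hμi := hμ i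
  have heq : policyLoss X Y i = fun ω ↦ μ i * ((μ i)⁻¹ * X i ω * (Y i ω : ℝ)) := by
    ext ω
    simp only [policyLoss]
    field_simp
  rw [heq, variance_const_mul]
  refine ⟨h1.const_mul _, by positivity, ?_⟩
  simp_rw [integral_const_mul, ← mul_sub, mul_pow]
  rw [integral_const_mul]
  simp_rw [← mul_pow]
  calc _ ≤ μ i ^ 4 * _ := mul_le_mul_of_nonneg_left h3 (by positivity)
    _ = _ := by ring

theorem mainTheorem4 {Ω : Type*} [MeasurableSpace Ω] (P : Measure Ω) [IsProbabilityMeasure P]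
    (X : ℕ → Ω → ℝ) (Y : ℕ → Ω → ℕ)
    (hindep : iIndepFun (policyLoss X Y) P) :
    ((∀ i, MemLp (policyLoss X Y i) 2 P) →
      (∃ i, 0 < Var[policyLoss X Y i; P]) →
      LindebergCondition P (policyLoss X Y) →
      AsymptoticallyStdNormal P (policyLoss X Y) (totalLoss X Y)) ∧
    (∀ (μ lam : ℕ → ℝ) (δ : ℝ) (C : ℝ → ℝ → ℝ),
      (∀ i, 0 < μ i) → (∀ i, 0 < lam i) → 0 < δ → IsCopula C →
      (∀ i, IsJointCopulaModel P (X i) (Y i) (μ i) δ (lam i) C) →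
      (∀ i, MemLp (policyLoss X Y i) 2 P ∧ 0 < Var[policyLoss X Y i; P]) ∧
      ((∀ ε : ℝ, 0 < ε → ∀ᶠ n : ℕ in atTop, ∀ i < n,
          Var[policyLoss X Y i; P] ≤ ε * ∑ j ∈ Finset.range n, Var[policyLoss X Y j; P]) →
        AsymptoticallyStdNormal P (policyLoss X Y) (totalLoss X Y))) := by
  refine ⟨fun h2 hpos hLin ↦ asymptoticallyStdNormal_of_lindebergCondition hindep h2 hpos hLin, ?_⟩
  intro μ lam δ C hμ hlam hδ _ hmodel
  obtain ⟨K, hK0, hK⟩ := exists_kurtosis_policyLoss_le (P := P) hμ hlam hδ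
    (fun i ↦ (hmodel i).hasLaw_size) (fun i ↦ (hmodel i).hasLaw_number)
  have h2 (i) : MemLp (policyLoss X Y i) 2 P := (hK i).1.mono_exponent (by norm_num)
  refine ⟨fun i ↦ ⟨h2 i, (hK i).2.1⟩, fun hdom ↦ ?_⟩
  exact asymptoticallyStdNormal_of_lindebergCondition hindep h2 ⟨0, (hK 0).2.1⟩
    (lindebergCondition_of_kurtosis_le (fun i ↦ (hK i).1) ⟨0, (hK 0).2.1⟩ hK0
      (fun i ↦ (hK i).2.2) hdom)
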